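/- Let $V$ be a finite-dimensional complex vector space, let $\mathbb{T}((V))=\prod_{k\ge 0}V^{\otimes k}$ be the algebra of formal tensor series over $V$, with multiplication given by the tensor product, and write $T=T_{(0)}+T_{(1)}+T_{(2)}+\cdots$ with $T_{(k)}\in V^{\otimes k}$ for its elements. Let $\mathrm{Lie}(V)$ be the smallest linear subspace of the tensor algebra $\bigoplus_{k\ge 0}V^{\otimes k}$ that contains $V$ and is closed under the commutator bracket $[a,b]=a\otimes b-b\otimes a$. Put $\mathrm{Lie}^kV=\mathrm{Lie}(V)\cap V^{\otimes k}$, and call the elements of $\mathrm{Lie}((V))=\prod_{k\ge 0}\mathrm{Lie}^kV\subset\mathbb{T}((V))$ Lie series. Every Lie series $T$ has $T_{(0)}=0$, so $\exp(T)=\sum_{n\ge 0}\frac{1}{n!}T^{\otimes n}$ is defined; let $\varphi_k(T)\in V^{\otimes k}$ be its component of degree $k$. A tensor in $V^{\otimes k}$ is called symmetric if it is fixed by all permutations of the $k$ tensor factors. Let $T$ be a Lie series with $T_{(1)}\neq 0$, and let $k\geq 2$ be an integer. If $\varphi_k(T)$ is symmetric, then $T_{(i)}=0$ for every $i\in\{2,\ldots,k\}$.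 Moreover, for every $i\in\{1,\ldots,k\}$, one has $\varphi_i(T)=\frac{1}{i!}\,T_{(1)}^{\otimes i}$, and in particular $\varphi_i(T)$ is symmetric. -/

import Mathlib

open scoped TensorProduct

noncomputable section

/-- The space `𝕋((V)) = ∏ₖ V^{⊗k}` of formal tensor series over `V`. The component `T k` is the
homogeneous part of degree `k`. -/
abbrev TensorSeries (V : Type*) [AddCommGroup V] [Module ℂ V] : Type _ :=
  (k : ℕ) → ⨂[ℂ]^k V

namespace TensorSeries

variable {V : Type*} [AddCommGroup V] [Module ℂ V]

/-- The tensor product of homogeneous tensors of degrees `i` and `j`, viewed in degree `k = i + j`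
(concatenation: `(v₁ ⊗ ⋯ ⊗ vᵢ, w₁ ⊗ ⋯ ⊗ wⱼ) ↦ v₁ ⊗ ⋯ ⊗ vᵢ ⊗ w₁ ⊗ ⋯ ⊗ wⱼ`). -/
def tmul {i j k : ℕ} (h : i + j = k) (a : ⨂[ℂ]^i V) (b : ⨂[ℂ]^j V) : ⨂[ℂ]^k V :=
  TensorPower.cast ℂ V h (TensorPower.mulEquiv (a ⊗ₜ[ℂ] b))

/-- The unit tensor series, `1 ∈ V^{⊗0} = ℂ`. -/
def one : TensorSeries V :=
  Pi.single 0 (PiTensorProduct.tprod ℂ Fin.elim0)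

/-- The product of `𝕋((V))`: `(S T)ₖ = ∑_{i + j = k} Sᵢ ⊗ Tⱼ`. -/
def mul (S T : TensorSeries V) : TensorSeries V := fun k =>
  ∑ p : Finset.HasAntidiagonal.antidiagonal k, tmul (Finset.HasAntidiagonal.mem_antidiagonal.mp p.2) (S p.1.1) (T p.1.2)

/-- The powers `T^{⊗n}` in `𝕋((V))`. -/
def pow (T : TensorSeries V) : ℕ → TensorSeries V
  | 0 => one
  | n + 1 => mul (pow T n) T

/-- If `T₀ = 0` then `T^{⊗n}` has no component in degrees below `n`. -/
theorem pow_eq_zero_of_lt (T : TensorSeries V) (h0 : T 0 = 0) :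
    ∀ {n k : ℕ}, k < n → pow T n k = 0
  | 0, _, h => absurd h (Nat.not_lt_zero _)
  | n + 1, k, h => by
    rw [pow, mul]
    refine Finset.sum_eq_zero fun p _ => ?_
    obtain ⟨⟨i, j⟩, hp⟩ := p
    have hij : i + j = k := Finset.HasAntidiagonal.mem_antidiagonal.mp hp
    rcases Nat.eq_zero_or_pos j with rfl | hj
    · simp [tmul, h0]
    · simp [tmul, pow_eq_zero_of_lt T h0 (show i < n by omega)]

/-- The exponential `exp T = ∑ₙ T^{⊗n} / n!` of a tensor series with `T₀ = 0`. Its component of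
degree `k` only involves the terms `n ≤ k`, since `T^{⊗n}` vanishes in degrees `k < n`
(`TensorSeries.pow_eq_zero_of_lt`). -/
def exp (T : TensorSeries V) : TensorSeries V := fun k =>
  ∑ n ∈ Finset.range (k + 1), ((n.factorial : ℂ)⁻¹) • pow T n k

/-- The `k`-th level `φₖ(T) = pₖ(exp T) ∈ V^{⊗k}`. -/
def level (k : ℕ) (T : TensorSeries V) : ⨂[ℂ]^k V :=
  exp T k

end TensorSeries

section Lie

variable (V : Type*) [AddCommGroup V] [Module ℂ V]

/-- The free Lie algebra `Lie(V)`: the smallest linear subspace of the tensor algebra `⨁ₖ V^{⊗k}`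
that contains `V` and is closed under the commutator bracket. -/
def freeLie : Submodule ℂ (TensorAlgebra ℂ V) :=
  sInf {L | (∀ v : V, TensorAlgebra.ι ℂ v ∈ L) ∧ ∀ a ∈ L, ∀ b ∈ L, a * b - b * a ∈ L}

/-- `Lieᵏ V = Lie(V) ∩ V^{⊗k}`, where `V^{⊗k}` is embedded in the tensor algebra in the usual way,
`v₁ ⊗ ⋯ ⊗ vₖ ↦ v₁ ⋯ vₖ`. -/
def freeLieDegree (k : ℕ) : Submodule ℂ (⨂[ℂ]^k V) :=
  (freeLie V).comap TensorPower.toTensorAlgebra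

/-- `Lie((V)) = ∏ₖ Lieᵏ V`, the space of Lie series. -/
def LieSeries : Submodule ℂ (TensorSeries V) :=
  Submodule.pi Set.univ (freeLieDegree V)

variable {V}

/-- A Lie series has no constant term, so that its exponential is defined. -/
theorem LieSeries.apply_zero {T : TensorSeries V} (hT : T ∈ LieSeries V) : T 0 = 0 := by
  have h : TensorPower.toTensorAlgebra (T 0) ∈ freeLie V := hT 0 (Set.mem_univ _)
  have hle : freeLie V ≤ LinearMap.ker
      (TensorAlgebra.algebraMapInv (R := ℂ) (M := V)).toLinearMap := by
    refine sInf_le ⟨fun v => ?_, fun a _ b _ => ?_⟩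
    · simp [TensorAlgebra.algebraMapInv]
    · simp [mul_comm]
  have h1 : TensorAlgebra.algebraMapInv (TensorPower.toTensorAlgebra (T 0)) = 0 := by
    simpa using hle h
  obtain ⟨c, hc⟩ : ∃ c : ℂ, T 0 = c • PiTensorProduct.tprod ℂ (Fin.elim0 : Fin 0 → V) := by
    refine ⟨PiTensorProduct.isEmptyEquiv (Fin 0) (T 0), ?_⟩
    apply (PiTensorProduct.isEmptyEquiv (R := ℂ) (s := fun _ : Fin 0 => V) (Fin 0)).injective
    simp
  rw [hc] at h1 ⊢
  simp at h1
  simp [h1]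

end Lie

/-- A tensor in `V^{⊗k}` is symmetric if it is fixed by all permutations of the `k` factors. -/
def IsSymmetricTensor {V : Type*} [AddCommGroup V] [Module ℂ V] {k : ℕ} (t : ⨂[ℂ]^k V) : Prop :=
  ∀ σ : Equiv.Perm (Fin k), PiTensorProduct.reindex ℂ (fun _ => V) σ t = t

/-- The power `x^{⊗i} ∈ V^{⊗i}` of `x ∈ V^{⊗1} = V`. -/
def degreeOnePower {V : Type*} [AddCommGroup V] [Module ℂ V] (x : ⨂[ℂ]^1 V) (i : ℕ) :
    ⨂[ℂ]^i V :=
  PiTensorProduct.tprod ℂ fun _ => PiTensorProduct.subsingletonEquiv (0 : Fin 1) x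

end

/-!
The exponential of a Lie series is group-like, and only the consequences of this in the shape of
derivations are needed. For `ξ : V →ₗ ℂ` let `d` be the derivation of the tensor algebra with
`d v = ξ v` for `v : V`. A commutator of two elements that `d` maps to scalars is killed by `d`, so
`d` maps every Lie element to a scalar; hence it kills the Lie elements of degree at least two
(`contractDeriv_eq_zero_of_mem_freeLie`), and `d (T₁ + T₂ + ⋯) = ξ T₁`. Since this is central, the
Leibniz rule gives `d (φₖ₊₁ T) = ξ(T₁) φₖ T` (`contractDeriv_level`).

On `v₀ ⊗ ⋯ ⊗ vₖ`, on the other hand, `d` is the sum over `i` of "move `vᵢ` to the front, then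
contract it with `ξ`". On a symmetric tensor all these terms agree, so `d` is `k + 1` times the
contraction of the first factor (`contractDeriv_of_isSymmetricTensor`). If `φₖ₊₁ T` is symmetric,
comparing the two formulas for `ξ` in a dual basis yields `(k + 1) φₖ₊₁ T = T₁ ⊗ φₖ T`, and choosing
`ξ` with `ξ T₁ = 1` shows that `φₖ T`, being a contraction of a symmetric tensor, is symmetric too.
Descending from `k`, all `φᵢ T` with `i ≤ k` are symmetric and equal to `T₁^{⊗i} / i!`.

Finally `φᵢ T = Tᵢ + T₁^{⊗i} / i!` as soon as `T₂, …, Tᵢ₋₁` vanish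
(`coeff_pow_of_coeff_eq_zero`), so `Tᵢ = 0` for `2 ≤ i ≤ k` by induction.
-/

open scoped TensorProduct

noncomputable section

/-! ### Powers of a noncommutative power series -/

/-- If `f = x X + O(Xⁱ)`, then `fⁿ = xⁿ Xⁿ + O(Xⁿ⁺ⁱ⁻¹)`. -/
theorem coeff_pow_of_coeff_eq_zero {A : Type*} [Semiring A] (f : PowerSeries A) {i : ℕ}
    (h0 : f.coeff 0 = 0) (h : ∀ j, 2 ≤ j → j < i → f.coeff j = 0) (n : ℕ) :
    ∀ m, m + 1 < n + i → (f ^ n).coeff m = if m = n then f.coeff 1 ^ n else 0 := by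
  induction n with
  | zero => intro m _; simp [PowerSeries.coeff_one]
  | succ n ih =>
    intro m hm
    -- of the products `(fⁿ)ₐ f_b` with `a + b = m`, only the one with `(a, b) = (n, 1)` survives
    have key : ∀ p ∈ Finset.HasAntidiagonal.antidiagonal m, (f ^ n).coeff p.1 * f.coeff p.2 =
        if p = (n, 1) then f.coeff 1 ^ (n + 1) else 0 := by
      rintro ⟨a, b⟩ hp
      have hab : a + b = m := by simpa using hp
      rcases Nat.eq_zero_or_pos b with rfl | hb
      · simp [h0]
      · dsimp only
        rw [ih a (by omega)]
        by_cases han : a = n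
        · rcases eq_or_ne b 1 with rfl | hb1
          · simp [han, pow_succ]
          · simp [h b (by omega) (by omega), hb1]
        · simp [han]
    rw [pow_succ, PowerSeries.coeff_mul, Finset.sum_congr rfl key, Finset.sum_ite_eq']
    simp [eq_comm]

/-! ### The contraction derivation of the tensor algebra -/

section ContractDeriv

variable {V : Type*} [AddCommGroup V] [Module ℂ V]

/-- The algebra map `a ↦ a + ε d(a)` into the dual numbers over the tensor algebra, where `d` is the
derivation that extends `ξ`. -/
def contractDerivHom (ξ : V →ₗ[ℂ] ℂ) :
    TensorAlgebra ℂ V →ₐ[ℂ] TrivSqZeroExt (TensorAlgebra ℂ V) (TensorAlgebra ℂ V) :=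
  TensorAlgebra.lift ℂ
    ((TrivSqZeroExt.inlAlgHom ℂ (TensorAlgebra ℂ V) (TensorAlgebra ℂ V)).toLinearMap ∘ₗ
        TensorAlgebra.ι ℂ +
      ((TrivSqZeroExt.inrHom (TensorAlgebra ℂ V) (TensorAlgebra ℂ V)).restrictScalars ℂ) ∘ₗ
        (Algebra.linearMap ℂ (TensorAlgebra ℂ V)) ∘ₗ ξ)

/-- The derivation `d` of the tensor algebra with `d v = ξ v` for `v : V`. It is encoded as a linear
map, since Mathlib's `Derivation` requires a commutative algebra. -/
def contractDeriv (ξ : V →ₗ[ℂ] ℂ) : TensorAlgebra ℂ V →ₗ[ℂ] TensorAlgebra ℂ V :=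
  (TrivSqZeroExt.sndHom (TensorAlgebra ℂ V) (TensorAlgebra ℂ V)).restrictScalars ℂ ∘ₗ
    (contractDerivHom ξ).toLinearMap

theorem fst_contractDerivHom (ξ : V →ₗ[ℂ] ℂ) (a : TensorAlgebra ℂ V) :
    (contractDerivHom ξ a).fst = a := by
  have h : (TrivSqZeroExt.fstHom ℂ (TensorAlgebra ℂ V) (TensorAlgebra ℂ V)).comp
      (contractDerivHom ξ) = AlgHom.id ℂ _ := by
    ext v
    simp [contractDerivHom]
  exact AlgHom.congr_fun h a

theorem contractDeriv_mul (ξ : V →ₗ[ℂ] ℂ) (a b : TensorAlgebra ℂ V) :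
    contractDeriv ξ (a * b) = a * contractDeriv ξ b + contractDeriv ξ a * b := by
  simp [contractDeriv, fst_contractDerivHom]

theorem contractDeriv_ι (ξ : V →ₗ[ℂ] ℂ) (v : V) :
    contractDeriv ξ (TensorAlgebra.ι ℂ v) = algebraMap ℂ _ (ξ v) := by
  simp [contractDeriv, contractDerivHom, Algebra.algebraMap_eq_smul_one]

theorem contractDeriv_one (ξ : V →ₗ[ℂ] ℂ) : contractDeriv ξ 1 = 0 := by
  simp [contractDeriv]

theorem contractDeriv_mem_range_algebraMap (ξ : V →ₗ[ℂ] ℂ) {a : TensorAlgebra ℂ V}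
    (ha : a ∈ freeLie V) : ∃ c : ℂ, contractDeriv ξ a = algebraMap ℂ _ c := by
  have hle : freeLie V ≤
      (LinearMap.range (Algebra.linearMap ℂ (TensorAlgebra ℂ V))).comap (contractDeriv ξ) := by
    refine sInf_le ⟨fun v => ⟨ξ v, by simp [contractDeriv_ι]⟩, ?_⟩
    rintro a ⟨c, hc⟩ b ⟨c', hc'⟩
    refine ⟨0, ?_⟩
    rw [Algebra.linearMap_apply] at hc hc'
    rw [map_sub, contractDeriv_mul, contractDeriv_mul, ← hc, ← hc', Algebra.commutes c b,
      Algebra.commutes c' a, map_zero]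
    abel
  obtain ⟨c, hc⟩ := hle ha
  exact ⟨c, hc.symm⟩

/-! ### Contraction of the first factor of a tensor -/

/-- The contraction `v₀ ⊗ ⋯ ⊗ vₖ ↦ ξ(v₀) v₁ ⊗ ⋯ ⊗ vₖ` of the first factor with `ξ`. -/
def contractHead (ξ : V →ₗ[ℂ] ℂ) (k : ℕ) : (⨂[ℂ]^(k + 1) V) →ₗ[ℂ] ⨂[ℂ]^k V :=
  PiTensorProduct.lift
    (LinearMap.uncurryLeft (M := fun _ : Fin (k + 1) => V)
      (ξ.smulRight (PiTensorProduct.tprod ℂ (s := fun _ : Fin k => V))))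

theorem contractHead_tprod (ξ : V →ₗ[ℂ] ℂ) {k : ℕ} (v : Fin (k + 1) → V) :
    contractHead ξ k (PiTensorProduct.tprod ℂ v) =
      ξ (v 0) • PiTensorProduct.tprod ℂ (fun j : Fin k => v j.succ) := by
  simp [contractHead, Fin.tail_def]

theorem IsSymmetricTensor.contractHead (ξ : V →ₗ[ℂ] ℂ) {k : ℕ} {t : ⨂[ℂ]^(k + 1) V}
    (ht : IsSymmetricTensor t) : IsSymmetricTensor (contractHead ξ k t) := by
  intro σ
  -- the permutation `σ'` of `Fin (k + 1)` fixes `0` and acts as `σ` on the other indices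
  let σ' : Equiv.Perm (Fin (k + 1)) := (Equiv.Perm.decomposeFin.symm (0, σ.symm)).symm
  have h : (PiTensorProduct.reindex ℂ (fun _ => V) σ).toLinearMap ∘ₗ _root_.contractHead ξ k =
      _root_.contractHead ξ k ∘ₗ (PiTensorProduct.reindex ℂ (fun _ => V) σ').toLinearMap := by
    refine PiTensorProduct.ext (MultilinearMap.ext fun v => ?_)
    simp [contractHead_tprod, PiTensorProduct.reindex_tprod, σ']
  have h' := LinearMap.congr_fun h t
  simp only [LinearMap.comp_apply, LinearEquiv.coe_coe] at h'
  rw [h', ht σ']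

theorem toTensorAlgebra_tprod_succ {k : ℕ} (v : Fin (k + 1) → V) :
    TensorPower.toTensorAlgebra (PiTensorProduct.tprod ℂ v) = TensorAlgebra.ι ℂ (v 0) *
      TensorPower.toTensorAlgebra (PiTensorProduct.tprod ℂ fun j : Fin k => v j.succ) := by
  simp [TensorAlgebra.tprod_apply, List.ofFn_succ]

theorem contractDeriv_tprod (ξ : V →ₗ[ℂ] ℂ) : ∀ {k : ℕ} (v : Fin (k + 1) → V),
    contractDeriv ξ (TensorPower.toTensorAlgebra (PiTensorProduct.tprod ℂ v)) =
      ∑ i, ξ (v i) • TensorPower.toTensorAlgebra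
        (PiTensorProduct.tprod ℂ fun j : Fin k => v (i.succAbove j))
  | 0, v => by
    simp [TensorAlgebra.tprod_apply, contractDeriv_ι, Algebra.algebraMap_eq_smul_one]
  | k + 1, v => by
    rw [toTensorAlgebra_tprod_succ, contractDeriv_mul, contractDeriv_tprod ξ, contractDeriv_ι,
      Fin.sum_univ_succ (n := k + 1), ← Algebra.smul_def, add_comm, Finset.mul_sum]
    congr 1
    refine Finset.sum_congr rfl fun i _ => ?_
    rw [toTensorAlgebra_tprod_succ (fun j => v (i.succ.succAbove j)), mul_smul_comm]
    simp

theorem contractDeriv_toTensorAlgebra (ξ : V →ₗ[ℂ] ℂ) {k : ℕ} (t : ⨂[ℂ]^(k + 1) V) :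
    contractDeriv ξ (TensorPower.toTensorAlgebra t) = TensorPower.toTensorAlgebra
      (∑ i : Fin (k + 1),
        contractHead ξ k (PiTensorProduct.reindex ℂ (fun _ => V) i.cycleRange t)) := by
  have h : contractDeriv ξ ∘ₗ TensorPower.toTensorAlgebra = TensorPower.toTensorAlgebra ∘ₗ
      ∑ i : Fin (k + 1), contractHead ξ k ∘ₗ
        (PiTensorProduct.reindex ℂ (fun _ => V) i.cycleRange).toLinearMap := by
    refine PiTensorProduct.ext (MultilinearMap.ext fun v => ?_)
    simp only [LinearMap.compMultilinearMap_apply, LinearMap.comp_apply, contractDeriv_tprod,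
      LinearMap.sum_apply, LinearEquiv.coe_coe, PiTensorProduct.reindex_tprod, contractHead_tprod,
      map_sum, map_smul, Fin.cycleRange_symm_zero, Fin.cycleRange_symm_succ]
  simpa [-map_sum] using LinearMap.congr_fun h t

theorem contractDeriv_of_isSymmetricTensor (ξ : V →ₗ[ℂ] ℂ) {k : ℕ} {t : ⨂[ℂ]^(k + 1) V}
    (ht : IsSymmetricTensor t) :
    contractDeriv ξ (TensorPower.toTensorAlgebra t) =
      ((k + 1 : ℕ) : ℂ) • TensorPower.toTensorAlgebra (contractHead ξ k t) := by
  rw [contractDeriv_toTensorAlgebra, Finset.sum_congr rfl fun i _ => by rw [ht i.cycleRange],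
    Finset.sum_const, Finset.card_univ, Fintype.card_fin, map_nsmul, Nat.cast_smul_eq_nsmul]

/-- `∑ᵦ eᵦ ⊗ ⟨eᵦ*, t⟩ = t`, where the contraction is in the first factor. -/
theorem sum_ι_mul_contractHead {ι : Type*} [Fintype ι] (e : Module.Basis ι ℂ V) {k : ℕ}
    (t : ⨂[ℂ]^(k + 1) V) :
    ∑ b, TensorAlgebra.ι ℂ (e b) * TensorPower.toTensorAlgebra (contractHead (e.coord b) k t) =
      TensorPower.toTensorAlgebra t := by
  have h : ∑ b, LinearMap.mulLeft ℂ (TensorAlgebra.ι ℂ (e b)) ∘ₗ TensorPower.toTensorAlgebra ∘ₗ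
      contractHead (e.coord b) k = TensorPower.toTensorAlgebra := by
    refine PiTensorProduct.ext (MultilinearMap.ext fun v => ?_)
    simp only [LinearMap.compMultilinearMap_apply, LinearMap.sum_apply, LinearMap.comp_apply,
      contractHead_tprod, map_smul, LinearMap.mulLeft_apply]
    rw [toTensorAlgebra_tprod_succ]
    conv_rhs => rw [← e.sum_repr (v 0), map_sum, Finset.sum_mul]
    simp only [map_smul, smul_mul_assoc, Module.Basis.coord_apply]
  simpa using LinearMap.congr_fun h t

theorem algebraMapInv_toTensorAlgebra_succ {k : ℕ} (t : ⨂[ℂ]^(k + 1) V) :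
    TensorAlgebra.algebraMapInv (TensorPower.toTensorAlgebra t) = (0 : ℂ) := by
  have h : (TensorAlgebra.algebraMapInv (R := ℂ) (M := V)).toLinearMap ∘ₗ
      TensorPower.toTensorAlgebra (n := k + 1) = 0 := by
    refine PiTensorProduct.ext (MultilinearMap.ext fun v => ?_)
    simp only [LinearMap.compMultilinearMap_apply, LinearMap.comp_apply, toTensorAlgebra_tprod_succ]
    simp [TensorAlgebra.algebraMapInv]
  exact LinearMap.congr_fun h t

/-- The derivative of a Lie element of degree at least two is a scalar that is homogeneous of
positive degree. -/
theorem contractDeriv_eq_zero_of_mem_freeLie (ξ : V →ₗ[ℂ] ℂ) {k : ℕ} {t : ⨂[ℂ]^(k + 2) V}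
    (ht : TensorPower.toTensorAlgebra t ∈ freeLie V) :
    contractDeriv ξ (TensorPower.toTensorAlgebra t) = 0 := by
  obtain ⟨c, hc⟩ := contractDeriv_mem_range_algebraMap ξ ht
  have h := congrArg TensorAlgebra.algebraMapInv hc
  rw [contractDeriv_toTensorAlgebra, algebraMapInv_toTensorAlgebra_succ,
    TensorAlgebra.algebraMap_leftInverse V c] at h
  rw [hc, ← h, map_zero]

theorem toTensorAlgebra_injective (k : ℕ) :
    Function.Injective (TensorPower.toTensorAlgebra : (⨂[ℂ]^k V) →ₗ[ℂ] TensorAlgebra ℂ V) := by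
  have h : (TensorAlgebra.toDirectSum (R := ℂ) (M := V)).toLinearMap ∘ₗ
      TensorPower.toTensorAlgebra = DirectSum.lof ℂ ℕ (fun n => ⨂[ℂ]^n V) k := by
    refine PiTensorProduct.ext (MultilinearMap.ext fun v => ?_)
    simp only [LinearMap.compMultilinearMap_apply, LinearMap.comp_apply,
      TensorPower.toTensorAlgebra_tprod, AlgHom.toLinearMap_apply,
      TensorAlgebra.toDirectSum_tensorPower_tprod, DirectSum.lof_eq_of]
  refine Function.Injective.of_comp (f := TensorAlgebra.toDirectSum) ?_
  have h' : (TensorAlgebra.toDirectSum : TensorAlgebra ℂ V → _) ∘ TensorPower.toTensorAlgebra =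
      DirectSum.of (fun n => ⨂[ℂ]^n V) k := funext fun t => LinearMap.congr_fun h t
  rw [h']
  exact DirectSum.of_injective k

end ContractDeriv

/-! ### Tensor series as power series over the tensor algebra -/

namespace TensorSeries

variable {V : Type*} [AddCommGroup V] [Module ℂ V]

/-- The power series `∑ₖ Tₖ Xᵏ` with coefficients in the tensor algebra. -/
def toPowerSeries (T : TensorSeries V) : PowerSeries (TensorAlgebra ℂ V) :=
  PowerSeries.mk fun k => TensorPower.toTensorAlgebra (T k)

theorem coeff_toPowerSeries (T : TensorSeries V) (k : ℕ) :
    (toPowerSeries T).coeff k = TensorPower.toTensorAlgebra (T k) :=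
  PowerSeries.coeff_mk _ _

theorem toTensorAlgebra_tmul {i j k : ℕ} (h : i + j = k) (a : ⨂[ℂ]^i V) (b : ⨂[ℂ]^j V) :
    TensorPower.toTensorAlgebra (tmul h a b) =
      TensorPower.toTensorAlgebra a * TensorPower.toTensorAlgebra b := by
  subst h
  rw [tmul, TensorPower.cast_refl, LinearEquiv.refl_apply, ← TensorPower.gMul_def,
    TensorPower.toTensorAlgebra_gMul]

theorem toPowerSeries_pow (T : TensorSeries V) (n : ℕ) :
    toPowerSeries (pow T n) = toPowerSeries T ^ n := by
  induction n with
  | zero =>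
    ext k
    rw [coeff_toPowerSeries, pow, one, pow_zero, PowerSeries.coeff_one]
    rcases eq_or_ne k 0 with rfl | hk
    · simp
    · simp [hk]
  | succ n ih =>
    ext k
    rw [coeff_toPowerSeries, pow, mul, pow_succ, PowerSeries.coeff_mul, map_sum,
      ← Finset.sum_coe_sort (Finset.HasAntidiagonal.antidiagonal k)]
    refine Finset.sum_congr rfl fun p _ => ?_
    rw [toTensorAlgebra_tmul, ← ih, coeff_toPowerSeries, coeff_toPowerSeries]

theorem toTensorAlgebra_level (T : TensorSeries V) (k : ℕ) :
    TensorPower.toTensorAlgebra (level k T) =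
      ∑ n ∈ Finset.range (k + 1), ((n.factorial : ℂ)⁻¹) • (toPowerSeries T ^ n).coeff k := by
  simp [level, exp, ← toPowerSeries_pow, coeff_toPowerSeries]

/-- The vector `T₁ ∈ V`. -/
abbrev degreeOne (T : TensorSeries V) : V :=
  PiTensorProduct.subsingletonEquiv (0 : Fin 1) (T 1)

theorem toTensorAlgebra_degree_one (T : TensorSeries V) :
    TensorPower.toTensorAlgebra (T 1) = TensorAlgebra.ι ℂ (degreeOne T) := by
  have h : T 1 = PiTensorProduct.tprod ℂ fun _ => degreeOne T :=
    (PiTensorProduct.subsingletonEquiv (0 : Fin 1)).injective (by simp)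
  rw [h]
  simp [TensorAlgebra.tprod_apply]

theorem toTensorAlgebra_degreeOnePower (T : TensorSeries V) (i : ℕ) :
    TensorPower.toTensorAlgebra (degreeOnePower (T 1) i) = TensorAlgebra.ι ℂ (degreeOne T) ^ i := by
  simp [degreeOnePower, TensorAlgebra.tprod_apply]

/-! ### The exponential of a Lie series -/

theorem contractDeriv_coeff_zero_pow (ξ : V →ₗ[ℂ] ℂ) {T : TensorSeries V} (hT : T ∈ LieSeries V)
    (n : ℕ) : contractDeriv ξ ((toPowerSeries T ^ n).coeff 0) = 0 := by
  have h0 : (toPowerSeries T).coeff 0 = 0 := by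
    rw [coeff_toPowerSeries, LieSeries.apply_zero hT, map_zero]
  rcases n with _ | n
  · simp [contractDeriv_one]
  · simp [pow_succ, PowerSeries.coeff_mul, h0]

theorem contractDeriv_coeff_toPowerSeries (ξ : V →ₗ[ℂ] ℂ) {T : TensorSeries V}
    (hT : T ∈ LieSeries V) (j : ℕ) : contractDeriv ξ ((toPowerSeries T).coeff j) =
      if j = 1 then algebraMap ℂ _ (ξ (degreeOne T)) else 0 := by
  rw [coeff_toPowerSeries]
  match j with
  | 0 => simp [LieSeries.apply_zero hT]
  | 1 => simp [toTensorAlgebra_degree_one, contractDeriv_ι]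
  | j + 2 => simpa using contractDeriv_eq_zero_of_mem_freeLie ξ (hT (j + 2) (Set.mem_univ _))

/-- The coefficientwise form of `d (fⁿ⁺¹) = (n + 1) ξ(T₁) X fⁿ` for `f = ∑ₖ Tₖ Xᵏ`, which holds
because `d f = ξ(T₁) X` is central. -/
theorem contractDeriv_coeff_pow (ξ : V →ₗ[ℂ] ℂ) {T : TensorSeries V} (hT : T ∈ LieSeries V)
    (n : ℕ) : ∀ k, contractDeriv ξ ((toPowerSeries T ^ (n + 1)).coeff (k + 1)) =
      (((n + 1 : ℕ) : ℂ) * ξ (degreeOne T)) • (toPowerSeries T ^ n).coeff k := by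
  induction n with
  | zero =>
    intro k
    rw [zero_add, pow_one, contractDeriv_coeff_toPowerSeries ξ hT, pow_zero, PowerSeries.coeff_one]
    by_cases hk : k = 0
    · simp [hk, Algebra.algebraMap_eq_smul_one]
    · simp [hk]
  | succ n ih =>
    intro k
    have hsum : ∑ p ∈ Finset.HasAntidiagonal.antidiagonal (k + 1),
        (toPowerSeries T ^ (n + 1)).coeff p.1 * contractDeriv ξ ((toPowerSeries T).coeff p.2) =
          ξ (degreeOne T) • (toPowerSeries T ^ (n + 1)).coeff k := by
      rw [Finset.sum_eq_single (k, 1)]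
      · rw [contractDeriv_coeff_toPowerSeries ξ hT, if_pos rfl, ← Algebra.commutes, Algebra.smul_def]
      · rintro ⟨a, b⟩ hp hne
        have hab : a + b = k + 1 := by simpa using hp
        have hb : b ≠ 1 := by
          rintro rfl
          exact hne (by simpa using hab)
        rw [contractDeriv_coeff_toPowerSeries ξ hT, if_neg hb, mul_zero]
      · intro h
        simp at h
    rw [pow_succ, PowerSeries.coeff_mul, map_sum]
    simp only [contractDeriv_mul]
    rw [Finset.sum_add_distrib, hsum, Finset.Nat.sum_antidiagonal_succ,
      contractDeriv_coeff_zero_pow ξ hT, zero_mul, zero_add]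
    simp only [ih, smul_mul_assoc]
    rw [← Finset.smul_sum, ← PowerSeries.coeff_mul, ← pow_succ, ← add_smul]
    congr 1
    push_cast
    ring

theorem contractDeriv_level (ξ : V →ₗ[ℂ] ℂ) {T : TensorSeries V} (hT : T ∈ LieSeries V) (k : ℕ) :
    contractDeriv ξ (TensorPower.toTensorAlgebra (level (k + 1) T)) =
      ξ (degreeOne T) • TensorPower.toTensorAlgebra (level k T) := by
  rw [toTensorAlgebra_level, toTensorAlgebra_level, map_sum, Finset.sum_range_succ',
    Finset.smul_sum]
  have h0 : contractDeriv ξ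
      (((Nat.factorial 0 : ℂ)⁻¹) • (toPowerSeries T ^ 0).coeff (k + 1)) = 0 := by
    simp [PowerSeries.coeff_one]
  rw [h0, add_zero]
  refine Finset.sum_congr rfl fun n _ => ?_
  rw [map_smul, contractDeriv_coeff_pow ξ hT, smul_smul, smul_smul]
  congr 1
  have hn : ((n + 1 : ℕ) : ℂ) ≠ 0 := Nat.cast_ne_zero.mpr n.succ_ne_zero
  rw [Nat.factorial_succ, Nat.cast_mul]
  field_simp

/-! ### Symmetric levels -/

theorem degreeOne_ne_zero {T : TensorSeries V} (hT1 : T 1 ≠ 0) : degreeOne T ≠ 0 :=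
  (LinearEquiv.map_ne_zero_iff _).mpr hT1

theorem isSymmetricTensor_level_of_succ {T : TensorSeries V} (hT : T ∈ LieSeries V)
    (hT1 : T 1 ≠ 0) {k : ℕ} (h : IsSymmetricTensor (level (k + 1) T)) :
    IsSymmetricTensor (level k T) := by
  obtain ⟨ξ, hξ⟩ := Module.Projective.exists_dual_eq_one ℂ (degreeOne_ne_zero hT1)
  have hlevel : level k T = ((k + 1 : ℕ) : ℂ) • contractHead ξ k (level (k + 1) T) := by
    apply toTensorAlgebra_injective
    rw [map_smul, ← contractDeriv_of_isSymmetricTensor ξ h, contractDeriv_level ξ hT, hξ, one_smul]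
  intro σ
  rw [hlevel, map_smul, h.contractHead ξ σ]

/-- If `φₖ₊₁(T)` is symmetric, then `(k + 1) φₖ₊₁(T) = T₁ ⊗ φₖ(T)`. -/
theorem succ_smul_level_succ [FiniteDimensional ℂ V] {T : TensorSeries V} (hT : T ∈ LieSeries V)
    {k : ℕ} (h : IsSymmetricTensor (level (k + 1) T)) :
    ((k + 1 : ℕ) : ℂ) • TensorPower.toTensorAlgebra (level (k + 1) T) =
      TensorAlgebra.ι ℂ (degreeOne T) * TensorPower.toTensorAlgebra (level k T) := by
  let e := Module.finBasis ℂ V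
  rw [← sum_ι_mul_contractHead e, Finset.smul_sum]
  conv_rhs => rw [← e.sum_repr (degreeOne T), map_sum, Finset.sum_mul]
  refine Finset.sum_congr rfl fun b _ => ?_
  rw [← mul_smul_comm, ← contractDeriv_of_isSymmetricTensor _ h, contractDeriv_level _ hT,
    Module.Basis.coord_apply, map_smul, smul_mul_assoc, mul_smul_comm]

theorem toTensorAlgebra_level_of_isSymmetricTensor [FiniteDimensional ℂ V] {T : TensorSeries V}
    (hT : T ∈ LieSeries V) (hT1 : T 1 ≠ 0) : ∀ {k : ℕ}, IsSymmetricTensor (level k T) →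
      TensorPower.toTensorAlgebra (level k T) =
        ((k.factorial : ℂ)⁻¹) • TensorAlgebra.ι ℂ (degreeOne T) ^ k
  | 0, _ => by simp [toTensorAlgebra_level]
  | k + 1, h => by
    have hk : ((k + 1 : ℕ) : ℂ) ≠ 0 := Nat.cast_ne_zero.mpr k.succ_ne_zero
    have ih := toTensorAlgebra_level_of_isSymmetricTensor hT hT1
      (isSymmetricTensor_level_of_succ hT hT1 h)
    have hs := succ_smul_level_succ hT h
    rw [ih, mul_smul_comm, ← pow_succ'] at hs
    rw [(eq_inv_smul_iff₀ hk).mpr hs, smul_smul, Nat.factorial_succ, Nat.cast_mul, mul_inv]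

/-- If `T₂, …, Tᵢ₋₁` vanish, then `φᵢ(T) = Tᵢ + T₁^{⊗i} / i!`. -/
theorem toTensorAlgebra_level_of_eq_zero {T : TensorSeries V} (h0 : T 0 = 0) {i : ℕ} (hi : 2 ≤ i)
    (h : ∀ j, 2 ≤ j → j < i → T j = 0) :
    TensorPower.toTensorAlgebra (level i T) = TensorPower.toTensorAlgebra (T i) +
      ((i.factorial : ℂ)⁻¹) • TensorAlgebra.ι ℂ (degreeOne T) ^ i := by
  have hpow : ∀ n, 2 ≤ n → (toPowerSeries T ^ n).coeff i =
      if i = n then TensorAlgebra.ι ℂ (degreeOne T) ^ n else 0 := fun n hn => by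
    rw [coeff_pow_of_coeff_eq_zero (toPowerSeries T) (i := i) (by simp [coeff_toPowerSeries, h0])
      (fun j hj hji => by simp [coeff_toPowerSeries, h j hj hji]) n i (by omega),
      coeff_toPowerSeries, toTensorAlgebra_degree_one]
  obtain ⟨m, rfl⟩ : ∃ m, i = m + 2 := ⟨i - 2, by omega⟩
  rw [toTensorAlgebra_level, Finset.sum_range_succ', Finset.sum_range_succ', Finset.sum_range_succ,
    Finset.sum_eq_zero fun n hn => by
      rw [hpow _ (by omega), if_neg (by have := Finset.mem_range.mp hn; omega), smul_zero],
    hpow _ (by omega), if_pos rfl]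
  simp [PowerSeries.coeff_one, coeff_toPowerSeries, add_comm (TensorPower.toTensorAlgebra _)]

end TensorSeries

end

theorem mainTheorem3 {V : Type*} [AddCommGroup V] [Module ℂ V] [FiniteDimensional ℂ V]
    (T : TensorSeries V) (hT : T ∈ LieSeries V) (hT1 : T 1 ≠ 0)
    (k : ℕ) (hk : 2 ≤ k) (hsymm : IsSymmetricTensor (TensorSeries.level k T)) :
    (∀ i : ℕ, 2 ≤ i → i ≤ k → T i = 0) ∧
      (∀ i : ℕ, 1 ≤ i → i ≤ k →
        IsSymmetricTensor (TensorSeries.level i T) ∧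
          TensorSeries.level i T = ((i.factorial : ℂ)⁻¹) • degreeOnePower (T 1) i) := by
  have hlevelsymm : ∀ i, i ≤ k → IsSymmetricTensor (TensorSeries.level i T) := fun i hi =>
    Nat.decreasingInduction' (P := fun i => IsSymmetricTensor (TensorSeries.level i T))
      (fun _ _ _ h => TensorSeries.isSymmetricTensor_level_of_succ hT hT1 h) hi hsymm
  have hlevel := fun i hi => TensorSeries.toTensorAlgebra_level_of_isSymmetricTensor hT hT1
    (hlevelsymm i hi)
  refine ⟨fun i => ?_, fun i _ hi => ⟨hlevelsymm i hi, toTensorAlgebra_injective i ?_⟩⟩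
  · induction i using Nat.strong_induction_on with
    | _ i ih =>
      intro h2 hi
      have h := TensorSeries.toTensorAlgebra_level_of_eq_zero (LieSeries.apply_zero hT) h2
        fun j hj hji => ih j hji hj (hji.le.trans hi)
      rw [hlevel i hi, right_eq_add] at h
      exact toTensorAlgebra_injective i (h.trans (map_zero _).symm)
  · rw [hlevel i hi, map_smul, TensorSeries.toTensorAlgebra_degreeOnePower]
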